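/- **Lemma 3.1 (Harnack's inequality).** Let $d\ge 1$, let $\Omega\subseteq\mathbb{R}^d$ be a domain (a nonempty connected open set, not necessarily bounded), let $U$ be a subdomain with $U\subset\subset\Omega$ (that is, $\overline U$ is compact and $\overline U\subseteq\Omega$), and let $M\ge 0$. Then there is a constant $C>0$, depending only on $d$, $U$, $\Omega$ and $M$, with the following property. Let $p\in L^\infty(\Omega)$ be real-valued with $p\ge 0$ a.e. in $\Omega$ and $\|p\|_{L^\infty(\Omega)}\le M$, let $\lambda>0$ be a constant, and let $u\in C^2(\Omega)$ be real-valued with $u\ge 0$ in $\Omega$ and $$-\Delta u+(\lambda+p(x))\,u=0\quad\text{for a.e. }x\in\Omega .$$ Then $u$ is bounded on $U$ and $$\sup_{U}u\;\le\;e^{C(1+\lambda)}\,\inf_{U}u .$$ -/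

import Mathlib

open MeasureTheory
open scoped ENNReal NNReal

/-- A domain in `ℝᵈ`: a nonempty connected open set. -/
def IsDomainIn {d : ℕ} (Ω : Set (EuclideanSpace ℝ (Fin d))) : Prop :=
  IsOpen Ω ∧ IsConnected Ω

/-- `U ⊂⊂ Ω`: the closure of `U` is compact and contained in `Ω`. -/
def CompactlyContained {d : ℕ} (U Ω : Set (EuclideanSpace ℝ (Fin d))) : Prop :=
  IsCompact (closure U) ∧ closure U ⊆ Ω

/-- `u` is a `C²` solution of `-Δu + (lam + p) u = 0` in `Ω`. Since `p` is only an `L^∞` function,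
the equation is required almost everywhere in `Ω`. -/
def IsC2Solution {d : ℕ} (Ω : Set (EuclideanSpace ℝ (Fin d)))
    (p : EuclideanSpace ℝ (Fin d) → ℝ) (lam : ℝ) (u : EuclideanSpace ℝ (Fin d) → ℝ) : Prop :=
  ContDiffOn ℝ 2 u Ω ∧
    ∀ᵐ x ∂(volume.restrict Ω), -(Laplacian.laplacian u x) + (lam + p x) * u x = 0

/-! Since `0 ≤ p ≤ M` a.e., continuity of `Δu` turns the equation into `0 ≤ Δu ≤ K u` on all of `Ω`,
with `K = lam + M`; nothing else about `p` is used. Locally, consider `m(s) = ∫ cap z * u (y + s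
z)`. The weight is chosen so that `-cap z • z` is the gradient of `cap² / 4`; one integration by
parts gives `m'(s) = s ∫ (cap² / 4) Δu`. Hence `m` increases, while `cap² ≤ cap` gives `m' ≤ (K / 4)
s m` and a Gronwall bound. Comparing the means at `x` with radius `r` and at `y` with radius `4 r`
yields `u x ≤ A * u y`, where `log A` is affine in `K` (`harnack_closedBall`). A chain of balls
along the compact connected set `closure U`, of length independent of `u` and `lam`, gives `A ^ N`
(`IsCompact.exists_harnack_chain`). -/

/-! ### The radial weight and its potential -/

section Cap

open Metric

variable {E : Type*} [NormedAddCommGroup E]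

/-- The radial weight `(1 - ‖z‖²)₊`, supported in the closed unit ball. -/
noncomputable def cap (z : E) : ℝ := max 0 (1 - ‖z‖ ^ 2)

lemma cap_nonneg (z : E) : 0 ≤ cap z := le_max_left _ _

lemma cap_le_one (z : E) : cap z ≤ 1 := max_le zero_le_one (by nlinarith [norm_nonneg z])

lemma continuous_cap : Continuous (cap : E → ℝ) := by unfold cap; fun_prop

lemma cap_eq_zero {z : E} (hz : 1 ≤ ‖z‖) : cap z = 0 :=
  max_eq_left (by nlinarith)

lemma norm_lt_one_of_cap_ne_zero {z : E} (hz : cap z ≠ 0) : ‖z‖ < 1 := by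
  by_contra! h
  exact hz (cap_eq_zero h)

lemma cap_pos {z : E} (hz : ‖z‖ < 1) : 0 < cap z :=
  lt_max_of_lt_right (by nlinarith [norm_nonneg z])

/-- Squaring removes the corner of the positive part, so `cap²` is differentiable across the unit
sphere and integrating by parts leaves no boundary term. -/
lemma hasDerivAt_max_zero_sq (t : ℝ) :
    HasDerivAt (fun t : ℝ => max 0 t ^ 2) (2 * max 0 t) t := by
  rcases lt_trichotomy t 0 with ht | rfl | ht
  · rw [max_eq_left ht.le, mul_zero]
    refine (hasDerivAt_const t (0 : ℝ)).congr_of_eventuallyEq ?_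
    filter_upwards [eventually_lt_nhds ht] with x hx
    simp [max_eq_left hx.le]
  · have h : HasDerivAt (fun t : ℝ => t * |t|) 0 0 := by
      rw [hasDerivAt_iff_tendsto_slope]
      have h1 : Filter.Tendsto (fun t : ℝ => |t|) (nhdsWithin 0 {0}ᶜ) (nhds 0) := by
        have := (continuous_abs (G := ℝ)).tendsto 0
        rw [abs_zero] at this
        exact this.mono_left nhdsWithin_le_nhds
      refine h1.congr' ?_
      filter_upwards [self_mem_nhdsWithin] with x hx
      have hx : x ≠ 0 := hx
      simp [slope_def_field, hx]
    have h2 : (fun t : ℝ => max 0 t ^ 2) = fun t => (t ^ 2 + t * |t|) / 2 := by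
      ext x
      rcases le_total 0 x with hx | hx
      · rw [max_eq_right hx, abs_of_nonneg hx]; ring
      · rw [max_eq_left hx, abs_of_nonpos hx]; ring
    rw [h2]
    simpa using (((hasDerivAt_id (0 : ℝ)).pow 2).add h).div_const 2
  · rw [max_eq_right ht.le]
    have h : HasDerivAt (fun t : ℝ => t ^ 2) (2 * t) t := by
      simpa using hasDerivAt_pow 2 t
    refine h.congr_of_eventuallyEq ?_
    filter_upwards [eventually_gt_nhds ht] with x hx
    simp [max_eq_right hx.le]

variable [InnerProductSpace ℝ E]

lemma hasFDerivAt_cap_sq (z : E) :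
    HasFDerivAt (fun z : E => cap z ^ 2 / 4) (-(cap z • innerSL ℝ z)) z := by
  have h1 : HasFDerivAt (fun z : E => 1 - ‖z‖ ^ 2) (-(2 • innerSL ℝ z)) z :=
    (hasStrictFDerivAt_norm_sq z).hasFDerivAt.const_sub 1
  have h2 := ((hasDerivAt_max_zero_sq (1 - ‖z‖ ^ 2)).div_const 4).comp_hasFDerivAt z h1
  refine h2.congr_fderiv ?_
  ext w
  simp [cap]
  ring

/-! ### Weighted means and their dependence on the radius -/

section Mean

variable [MeasurableSpace E] (μ : Measure E)

/-- The unnormalized mean of `v` over the ball of center `y` and radius `s` with weight `cap`. -/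
noncomputable def capMean (v : E → ℝ) (y : E) (s : ℝ) : ℝ := ∫ z, cap z * v (y + s • z) ∂μ

lemma capMean_zero (v : E → ℝ) (y : E) : capMean μ v y 0 = (∫ z, cap z ∂μ) * v y := by
  simp [capMean, integral_mul_const]

end Mean

variable [FiniteDimensional ℝ E]

lemma hasCompactSupport_cap : HasCompactSupport (cap : E → ℝ) :=
  HasCompactSupport.intro (isCompact_closedBall (0 : E) 1) fun z hz => cap_eq_zero (by
    rw [mem_closedBall_zero_iff] at hz; linarith)

lemma laplacian_eq_sum_fderiv_fderiv (v : E → ℝ) (x : E) :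
    Laplacian.laplacian v x = ∑ i, fderiv ℝ (fderiv ℝ v) x (stdOrthonormalBasis ℝ E i)
      (stdOrthonormalBasis ℝ E i) := by
  rw [InnerProductSpace.laplacian_eq_iteratedFDeriv_stdOrthonormalBasis]
  simp [iteratedFDeriv_two_apply]

lemma continuous_laplacian {v : E → ℝ} (hv : ContDiff ℝ 2 v) :
    Continuous (Laplacian.laplacian v : E → ℝ) := by
  have h : Continuous (fderiv ℝ (fderiv ℝ v)) :=
    (hv.fderiv_right (m := 1) (by norm_num)).continuous_fderiv one_ne_zero
  have h2 : (Laplacian.laplacian v : E → ℝ) = fun x => ∑ i,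
      fderiv ℝ (fderiv ℝ v) x (stdOrthonormalBasis ℝ E i) (stdOrthonormalBasis ℝ E i) :=
    funext (laplacian_eq_sum_fderiv_fderiv v)
  rw [h2]
  fun_prop

variable [MeasurableSpace E] [BorelSpace E] (μ : Measure E) [μ.IsAddHaarMeasure]

lemma integrable_cap_mul {f : E → ℝ} (hf : Continuous f) :
    Integrable (fun z => cap z * f z) μ :=
  (continuous_cap.mul hf).integrable_of_hasCompactSupport hasCompactSupport_cap.mul_right

lemma integrable_cap_sq_mul {f : E → ℝ} (hf : Continuous f) :
    Integrable (fun z => cap z ^ 2 / 4 * f z) μ :=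
  (integrable_cap_mul μ ((continuous_cap.div_const 4).mul hf)).congr (ae_of_all _ fun z => by
    simp only [Pi.mul_apply]; ring)

lemma integral_cap_pos : 0 < ∫ z, cap z ∂μ := by
  refine continuous_cap.integral_pos_of_hasCompactSupport_nonneg_nonzero
    hasCompactSupport_cap cap_nonneg (x := 0) (cap_pos ?_).ne'
  simp

lemma hasDerivAt_capMean {v : E → ℝ} (hv : ContDiff ℝ 1 v) (y : E) (s : ℝ) :
    HasDerivAt (capMean μ v y) (∫ z, cap z * fderiv ℝ v (y + s • z) z ∂μ) s := by
  have hv' : Continuous (fderiv ℝ v) := hv.continuous_fderiv one_ne_zero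
  have hvc := hv.continuous
  have hcont : Continuous fun q : ℝ × E => fderiv ℝ v (y + q.1 • q.2) q.2 := by fun_prop
  obtain ⟨B, hB⟩ := ((isCompact_closedBall s 1).prod (isCompact_closedBall (0 : E) 1)
    ).exists_bound_of_continuousOn hcont.continuousOn
  refine (hasDerivAt_integral_of_dominated_loc_of_deriv_le (closedBall_mem_nhds s one_pos)
    (bound := fun z => cap z * B) (F := fun s z => cap z * v (y + s • z))
    (F' := fun s z => cap z * fderiv ℝ v (y + s • z) z) ?_ ?_ ?_ ?_ ?_ ?_).2
  · refine Filter.Eventually.of_forall fun t => ?_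
    exact (integrable_cap_mul μ (by fun_prop)).aestronglyMeasurable
  · exact integrable_cap_mul μ (by fun_prop)
  · exact (integrable_cap_mul μ (by fun_prop)).aestronglyMeasurable
  · refine ae_of_all _ fun z t ht => ?_
    rw [norm_mul, Real.norm_of_nonneg (cap_nonneg z)]
    by_cases hz : cap z = 0
    · simp [hz]
    · exact mul_le_mul_of_nonneg_left (hB (t, z) ⟨ht, mem_closedBall_zero_iff.2
        (norm_lt_one_of_cap_ne_zero hz).le⟩) (cap_nonneg z)
  · exact integrable_cap_mul μ continuous_const
  · refine ae_of_all _ fun z t _ => ?_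
    have h1 : HasDerivAt (fun t : ℝ => y + t • z) z t := by
      simpa using ((hasDerivAt_id t).smul_const z).const_add y
    exact (((hv.differentiable one_ne_zero _).hasFDerivAt).comp_hasDerivAt t h1).const_mul _

/-- Expand `z` in an orthonormal basis and integrate by parts against `cap² / 4` in each direction;
the factor `s` comes from the chain rule. -/
lemma integral_cap_mul_fderiv {v : E → ℝ} (hv : ContDiff ℝ 2 v) (y : E) (s : ℝ) :
    ∫ z, cap z * fderiv ℝ v (y + s • z) z ∂μ
      = s * ∫ z, cap z ^ 2 / 4 * Laplacian.laplacian v (y + s • z) ∂μ := by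
  set b := stdOrthonormalBasis ℝ E
  have hv1 : ContDiff ℝ 1 (fderiv ℝ v) := hv.fderiv_right (by norm_num)
  have hc1 : Continuous (fderiv ℝ v) := hv1.continuous
  have hc2 : Continuous (fderiv ℝ (fderiv ℝ v)) := hv1.continuous_fderiv one_ne_zero
  have hg : ∀ i z, HasFDerivAt (fun z => fderiv ℝ v (y + s • z) (b i))
      (s • (fderiv ℝ (fderiv ℝ v) (y + s • z)).flip (b i)) z := fun i z => by
    have h1 : HasFDerivAt (fun z : E => y + s • z) (s • ContinuousLinearMap.id ℝ E) z :=
      ((hasFDerivAt_id z).const_smul s).const_add y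
    have h2 := ((hv1.differentiable one_ne_zero (y + s • z)).hasFDerivAt.comp z h1).clm_apply
      (hasFDerivAt_const (b i) z)
    refine h2.congr_fderiv ?_
    ext w
    simp
  have key : ∀ i, ∫ z, cap z * (inner ℝ (b i) z * fderiv ℝ v (y + s • z) (b i)) ∂μ
      = ∫ z, s * (cap z ^ 2 / 4 * fderiv ℝ (fderiv ℝ v) (y + s • z) (b i) (b i)) ∂μ := fun i => by
    have hf : ∀ z : E, fderiv ℝ (fun z : E => cap z ^ 2 / 4) z (b i)
        = -(cap z * inner ℝ (b i) z) := fun z => by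
      rw [(hasFDerivAt_cap_sq z).fderiv]
      simp [real_inner_comm]
    have hg' : ∀ z : E, fderiv ℝ (fun z => fderiv ℝ v (y + s • z) (b i)) z (b i)
        = s * fderiv ℝ (fderiv ℝ v) (y + s • z) (b i) (b i) := fun z => by
      rw [(hg i z).fderiv]
      simp
    have := integral_mul_fderiv_eq_neg_fderiv_mul_of_integrable (μ := μ) (v := b i)
      (f := fun z : E => cap z ^ 2 / 4) (g := fun z => fderiv ℝ v (y + s • z) (b i)) ?_ ?_ ?_
      (fun z _ => (hasFDerivAt_cap_sq z).differentiableAt)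
      (fun z _ => (hg i z).differentiableAt)
    · simp only [hf, hg'] at this
      rw [← integral_neg] at this
      calc _ = ∫ z, -(-(cap z * inner ℝ (b i) z) * fderiv ℝ v (y + s • z) (b i)) ∂μ := by
            congr 1; ext z; ring
        _ = _ := by rw [← this]; congr 1; ext z; ring
    · simp only [hf]
      have : Continuous fun z => -(inner ℝ (b i) z * fderiv ℝ v (y + s • z) (b i)) := by fun_prop
      refine (integrable_cap_mul μ this).congr (ae_of_all _ fun z => ?_)
      simp only; ring
    · simp only [hg']
      exact integrable_cap_sq_mul μ (by fun_prop)
    · exact integrable_cap_sq_mul μ (by fun_prop)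
  have e1 : ∀ z, cap z * fderiv ℝ v (y + s • z) z
      = ∑ i, cap z * (inner ℝ (b i) z * fderiv ℝ v (y + s • z) (b i)) := fun z => by
    have h := congrArg (fderiv ℝ v (y + s • z)) (b.sum_repr' z)
    simp only [map_sum, map_smul, smul_eq_mul] at h
    rw [← Finset.mul_sum, h]
  simp only [e1]
  rw [integral_finsetSum _ fun i _ => integrable_cap_mul μ (by fun_prop), ← integral_const_mul]
  simp only [key, laplacian_eq_sum_fderiv_fderiv, Finset.mul_sum]
  rw [integral_finsetSum _ fun i _ => (integrable_cap_sq_mul μ (by fun_prop)).const_mul s]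

lemma hasDerivAt_capMean_laplacian {v : E → ℝ} (hv : ContDiff ℝ 2 v) (y : E) (s : ℝ) :
    HasDerivAt (capMean μ v y)
      (s * ∫ z, cap z ^ 2 / 4 * Laplacian.laplacian v (y + s • z) ∂μ) s := by
  rw [← integral_cap_mul_fderiv μ hv]
  exact hasDerivAt_capMean μ (hv.of_le (by norm_num)) y s

/-- Sub-mean value inequality. -/
lemma integral_cap_mul_le_capMean {v : E → ℝ} (hv : ContDiff ℝ 2 v) {y : E} {r : ℝ} (hr : 0 ≤ r)
    (hsub : ∀ x ∈ closedBall y r, 0 ≤ Laplacian.laplacian v x) :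
    (∫ z, cap z ∂μ) * v y ≤ capMean μ v y r := by
  rw [← capMean_zero]
  refine monotoneOn_of_deriv_nonneg (convex_Icc 0 r) (fun s _ =>
    (hasDerivAt_capMean_laplacian μ hv y s).continuousAt.continuousWithinAt)
    (fun s _ => (hasDerivAt_capMean_laplacian μ hv y s).differentiableAt.differentiableWithinAt)
    (fun s hs => ?_) (Set.left_mem_Icc.2 hr) (Set.right_mem_Icc.2 hr) hr
  rw [interior_Icc] at hs
  rw [(hasDerivAt_capMean_laplacian μ hv y s).deriv]
  refine mul_nonneg hs.1.le (integral_nonneg fun z => ?_)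
  by_cases hz : cap z = 0
  · simp [hz]
  · refine mul_nonneg (by positivity) (hsub _ ?_)
    have := norm_lt_one_of_cap_ne_zero hz
    rw [mem_closedBall, dist_self_add_left, norm_smul, Real.norm_of_nonneg hs.1.le]
    nlinarith [hs.1, hs.2]

/-- A super-mean value inequality for nonnegative `v` with `Δ v ≤ K v`. -/
lemma capMean_le_exp_mul {v : E → ℝ} (hv : ContDiff ℝ 2 v) {y : E} {r K : ℝ} (hr : 0 ≤ r)
    (hK : 0 ≤ K) (hnonneg : ∀ x ∈ closedBall y r, 0 ≤ v x)
    (hsuper : ∀ x ∈ closedBall y r, Laplacian.laplacian v x ≤ K * v x) :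
    capMean μ v y r ≤ Real.exp (K * r ^ 2 / 8) * ((∫ z, cap z ∂μ) * v y) := by
  -- Gronwall: the integrating factor for `m' ≤ (K / 4) s m`.
  have hd : ∀ s, HasDerivAt (fun s => Real.exp (-(K * s ^ 2 / 8)) * capMean μ v y s)
      (Real.exp (-(K * s ^ 2 / 8)) * (s * ((∫ z, cap z ^ 2 / 4 *
        Laplacian.laplacian v (y + s • z) ∂μ) - K / 4 * capMean μ v y s))) s := fun s => by
    have h1 : HasDerivAt (fun s : ℝ => -(K * s ^ 2 / 8)) (-(K * (2 * s) / 8)) s := by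
      simpa using (((hasDerivAt_pow 2 s).const_mul K).div_const 8).fun_neg
    refine (h1.exp.mul (hasDerivAt_capMean_laplacian μ hv y s)).congr_deriv ?_
    ring
  have hanti := antitoneOn_of_deriv_nonpos (convex_Icc 0 r)
    (fun s _ => (hd s).continuousAt.continuousWithinAt)
    (fun s _ => (hd s).differentiableAt.differentiableWithinAt)
    (fun s hs => ?_) (Set.left_mem_Icc.2 hr) (Set.right_mem_Icc.2 hr) hr
  · simp only [ne_eq, OfNat.ofNat_ne_zero, not_false_eq_true, zero_pow, mul_zero, zero_div,
      neg_zero, Real.exp_zero, one_mul, capMean_zero] at hanti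
    rwa [Real.exp_neg, inv_mul_le_iff₀ (Real.exp_pos _)] at hanti
  · rw [interior_Icc] at hs
    rw [(hd s).deriv]
    refine mul_nonpos_of_nonneg_of_nonpos (Real.exp_pos _).le
      (mul_nonpos_of_nonneg_of_nonpos hs.1.le (sub_nonpos.2 ?_))
    have hvc := hv.continuous
    have hlc := continuous_laplacian hv
    rw [capMean, ← integral_const_mul]
    refine integral_mono (integrable_cap_sq_mul μ (by fun_prop))
      ((integrable_cap_mul μ (by fun_prop)).const_mul _) fun z => ?_
    by_cases hz : cap z = 0
    · simp [hz]
    · have hz1 := norm_lt_one_of_cap_ne_zero hz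
      have hmem : y + s • z ∈ closedBall y r := by
        rw [mem_closedBall, dist_self_add_left, norm_smul, Real.norm_of_nonneg hs.1.le]
        nlinarith [hs.1, hs.2]
      have h1 := hsuper _ hmem
      have h2 := mul_nonneg hK (hnonneg _ hmem)
      have h3 := cap_nonneg z
      have h4 := cap_le_one z
      calc cap z ^ 2 / 4 * Laplacian.laplacian v (y + s • z)
          ≤ cap z ^ 2 / 4 * (K * v (y + s • z)) := by gcongr
        _ ≤ cap z / 4 * (K * v (y + s • z)) := by gcongr; nlinarith
        _ = _ := by ring

/-- Means over a small ball are controlled by means over a larger ball containing it. -/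
lemma capMean_le_capMean {v : E → ℝ} (hv : Continuous v) {x y : E} {r : ℝ} (hr : 0 < r)
    (hxy : dist x y ≤ r) (hnonneg : ∀ x ∈ closedBall y (4 * r), 0 ≤ v x) :
    capMean μ v x r ≤ 4 / 3 * 4 ^ Module.finrank ℝ E * capMean μ v y (4 * r) := by
  -- In the coordinates of the large ball, the small one has center `a` and radius `1 / 4`; the
  -- Jacobian gives `4 ^ finrank`.
  set a : E := (4 * r)⁻¹ • (x - y)
  have ha : ‖a‖ ≤ 1 / 4 := by
    rw [norm_smul, ← dist_eq_norm, norm_inv, Real.norm_of_nonneg (by positivity),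
      inv_mul_le_iff₀ (by positivity)]
    linarith
  have hpt : ∀ z : E, y + (4 * r) • (a + (1 / 4 : ℝ) • z) = x + r • z := fun z => by
    simp only [a, smul_add, smul_smul, mul_inv_cancel₀ (by positivity : (4 * r) ≠ 0), one_smul]
    rw [show 4 * r * (1 / 4) = r by ring]
    abel
  have hcv : capMean μ v y (4 * r) = ((4 : ℝ) ^ Module.finrank ℝ E)⁻¹ *
      ∫ z, cap (a + (1 / 4 : ℝ) • z) * v (x + r • z) ∂μ := by
    have h1 := Measure.integral_comp_smul μ
      (fun z => cap (a + z) * v (y + (4 * r) • (a + z))) (1 / 4 : ℝ)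
    simp only [hpt] at h1
    rw [h1, integral_add_left_eq_self (fun z => cap z * v (y + (4 * r) • z)) a, smul_eq_mul,
      capMean, ← mul_assoc, one_div, inv_pow, inv_inv, abs_of_nonneg (by positivity),
      inv_mul_cancel₀ (by positivity), one_mul]
  have hint : Integrable (fun z => cap (a + (1 / 4 : ℝ) • z) * v (x + r • z)) μ := by
    have h1 : Integrable (fun z => cap z * v (y + (4 * r) • z)) μ :=
      integrable_cap_mul μ (by fun_prop)
    have h2 := (h1.comp_add_left a).comp_smul (R := (1 / 4 : ℝ)) (by norm_num)
    simpa only [hpt] using h2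
  rw [hcv, mul_assoc, mul_inv_cancel_left₀ (by positivity), ← integral_const_mul, capMean]
  refine integral_mono (integrable_cap_mul μ (by fun_prop)) (hint.const_mul _) fun z => ?_
  have hnn : ∀ w : E, ‖w‖ ≤ 1 → 0 ≤ v (y + (4 * r) • w) := fun w hw => hnonneg _ (by
    rw [mem_closedBall, dist_self_add_left, norm_smul, Real.norm_of_nonneg (by linarith)]
    nlinarith)
  simp only
  rw [← hpt z]
  by_cases hz : cap z = 0
  · rw [hz, zero_mul]
    by_cases hw : cap (a + (1 / 4 : ℝ) • z) = 0
    · rw [hw, zero_mul, mul_zero]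
    · exact mul_nonneg (by norm_num) (mul_nonneg (cap_nonneg _)
        (hnn _ (norm_lt_one_of_cap_ne_zero hw).le))
  · have hz1 := norm_lt_one_of_cap_ne_zero hz
    have hw : ‖a + (1 / 4 : ℝ) • z‖ ≤ 1 / 2 := by
      refine (norm_add_le _ _).trans ?_
      rw [norm_smul (1 / 4 : ℝ) z, Real.norm_of_nonneg (by norm_num)]
      linarith
    -- The small ball lies in the half-radius ball, where `cap ≥ 1 - 1 / 4`; hence the constant `4 /
    -- 3`.
    have hcap : 3 / 4 ≤ cap (a + (1 / 4 : ℝ) • z) :=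
      le_max_of_le_right (by nlinarith [norm_nonneg (a + (1 / 4 : ℝ) • z)])
    have h0 := hnn _ (hw.trans (by norm_num))
    rw [← mul_assoc]
    exact mul_le_mul_of_nonneg_right (by linarith [cap_le_one z]) h0

end Cap

/-! ### Harnack's inequality on one ball -/

section LocalHarnack

open Metric Topology

variable {E : Type*} [NormedAddCommGroup E] [InnerProductSpace ℝ E] [FiniteDimensional ℝ E]

/-- Harnack's inequality on a ball for globally `C²` functions. -/
lemma harnack_closedBall_of_contDiff {v : E → ℝ} (hv : ContDiff ℝ 2 v) {x y : E} {r K : ℝ}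
    (hr : 0 < r) (hK : 0 ≤ K) (hxy : dist x y ≤ r)
    (hnonneg : ∀ z ∈ closedBall y (4 * r), 0 ≤ v z)
    (hsub : ∀ z ∈ closedBall y (4 * r), 0 ≤ Laplacian.laplacian v z)
    (hsuper : ∀ z ∈ closedBall y (4 * r), Laplacian.laplacian v z ≤ K * v z) :
    v x ≤ 4 / 3 * 4 ^ Module.finrank ℝ E * Real.exp (2 * K * r ^ 2) * v y := by
  borelize E
  let μ : Measure E := Measure.addHaar
  have hpos : 0 < ∫ z, cap z ∂μ := integral_cap_pos μ
  have hball : closedBall x r ⊆ closedBall y (4 * r) :=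
    closedBall_subset_closedBall' (by linarith)
  have h1 := integral_cap_mul_le_capMean μ hv hr.le fun z hz => hsub z (hball hz)
  have h2 := capMean_le_capMean μ hv.continuous hr hxy hnonneg
  have h3 := capMean_le_exp_mul μ hv (by positivity) hK hnonneg hsuper
  rw [show K * (4 * r) ^ 2 / 8 = 2 * K * r ^ 2 by ring] at h3
  refine le_of_mul_le_mul_left ?_ hpos
  calc (∫ z, cap z ∂μ) * v x
      ≤ 4 / 3 * 4 ^ Module.finrank ℝ E * capMean μ v y (4 * r) := h1.trans h2
    _ ≤ 4 / 3 * 4 ^ Module.finrank ℝ E *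
        (Real.exp (2 * K * r ^ 2) * ((∫ z, cap z ∂μ) * v y)) := by gcongr
    _ = _ := by ring

/-- Multiply by a smooth cutoff. Agreement near each point, not just at it, is what preserves the
Laplacian. -/
lemma ContDiffOn.exists_contDiff_eventuallyEq {Ω : Set E} {u : E → ℝ} (hΩ : IsOpen Ω)
    (hu : ContDiffOn ℝ 2 u Ω) {y : E} {R R' : ℝ} (hR : 0 < R) (hRR' : R < R')
    (hball : closedBall y R' ⊆ Ω) :
    ∃ v : E → ℝ, ContDiff ℝ 2 v ∧ ∀ x ∈ closedBall y R, v =ᶠ[𝓝 x] u := by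
  let χ : ContDiffBump y := ⟨(R + R') / 2, R', by linarith, by linarith⟩
  refine ⟨fun x => χ x * u x, contDiff_iff_contDiffAt.2 fun x => ?_, fun x hx => ?_⟩
  · by_cases hx : x ∈ closedBall y R'
    · exact χ.contDiffAt.mul (hu.contDiffAt (hΩ.mem_nhds (hball hx)))
    · refine (contDiffAt_const (c := (0 : ℝ))).congr_of_eventuallyEq ?_
      filter_upwards [isClosed_closedBall.isOpen_compl.mem_nhds hx] with z hz
      rw [χ.zero_of_le_dist (lt_of_not_ge fun h => hz (mem_closedBall.2 h)).le, zero_mul]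
  · have hx' : x ∈ ball y χ.rIn := closedBall_subset_ball (by simp only [χ]; linarith) hx
    filter_upwards [χ.eventuallyEq_one_of_mem_ball hx'] with z hz
    rw [hz, Pi.one_apply, one_mul]

/-- Harnack's inequality on a ball for nonnegative `u` with `0 ≤ Δ u ≤ K u`. -/
lemma harnack_closedBall {Ω : Set E} {u : E → ℝ} (hΩ : IsOpen Ω) (hu : ContDiffOn ℝ 2 u Ω)
    {K : ℝ} (hK : 0 ≤ K) (hnonneg : ∀ z ∈ Ω, 0 ≤ u z)
    (hsub : ∀ z ∈ Ω, 0 ≤ Laplacian.laplacian u z)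
    (hsuper : ∀ z ∈ Ω, Laplacian.laplacian u z ≤ K * u z)
    {x y : E} {r : ℝ} (hr : 0 < r) (hxy : dist x y ≤ r) (hball : closedBall y (5 * r) ⊆ Ω) :
    u x ≤ 4 / 3 * 4 ^ Module.finrank ℝ E * Real.exp (2 * K * r ^ 2) * u y := by
  obtain ⟨v, hv, hvu⟩ := hu.exists_contDiff_eventuallyEq hΩ (R := 4 * r) (by linarith)
    (by linarith : 4 * r < 5 * r) hball
  have hsubset : closedBall y (4 * r) ⊆ Ω :=
    (closedBall_subset_closedBall (by linarith)).trans hball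
  have hlap : ∀ z ∈ closedBall y (4 * r), Laplacian.laplacian v z = Laplacian.laplacian u z :=
    fun z hz => (InnerProductSpace.laplacian_congr_nhds (hvu z hz)).self_of_nhds
  have heq : ∀ z ∈ closedBall y (4 * r), v z = u z := fun z hz => (hvu z hz).self_of_nhds
  rw [← heq x (mem_closedBall.2 (by linarith)), ← heq y (mem_closedBall_self (by linarith))]
  refine harnack_closedBall_of_contDiff hv hr hK hxy (fun z hz => ?_) (fun z hz => ?_)
    fun z hz => ?_
  · rw [heq z hz]; exact hnonneg z (hsubset hz)
  · rw [hlap z hz]; exact hsub z (hsubset hz)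
  · rw [heq z hz, hlap z hz]; exact hsuper z (hsubset hz)

lemma ContDiffOn.continuousOn_laplacian {Ω : Set E} {u : E → ℝ} (hΩ : IsOpen Ω)
    (hu : ContDiffOn ℝ 2 u Ω) : ContinuousOn (Laplacian.laplacian u : E → ℝ) Ω := by
  intro x hx
  obtain ⟨R, hR, hball⟩ := nhds_basis_closedBall.mem_iff.1 (hΩ.mem_nhds hx)
  obtain ⟨v, hv, hvu⟩ := hu.exists_contDiff_eventuallyEq hΩ (half_pos hR) (half_lt_self hR) hball
  have h := InnerProductSpace.laplacian_congr_nhds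
    (hvu x (mem_closedBall_self (half_pos hR).le))
  exact ((continuous_laplacian hv).continuousAt.congr h).continuousWithinAt

end LocalHarnack

/-! ### Chains of balls in a compact connected set -/

section Chain

open Metric Topology

/-- Chaining: an inequality `u a ≤ A u b` between nearby points of a compact connected set
propagates to all pairs of points, with a number of steps independent of `u` and `A`. -/
lemma IsCompact.exists_harnack_chain {X : Type*} [PseudoMetricSpace X] {S : Set X}
    (hS : IsCompact S) (hconn : IsPreconnected S) {r : ℝ} (hr : 0 < r) :
    ∃ N : ℕ, ∀ (u : X → ℝ) (A : ℝ), 1 ≤ A → (∀ a ∈ S, 0 ≤ u a) →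
      (∀ a ∈ S, ∀ b ∈ S, dist a b ≤ r → u a ≤ A * u b) →
      ∀ a ∈ S, ∀ b ∈ S, u a ≤ A ^ N * u b := by
  let P : X → X → Prop := fun x y => ∃ n : ℕ, ∀ (u : X → ℝ) (A : ℝ), 1 ≤ A →
    (∀ a ∈ S, 0 ≤ u a) → (∀ a ∈ S, ∀ b ∈ S, dist a b ≤ r → u a ≤ A * u b) → u x ≤ A ^ n * u y
  have hP : ∀ x ∈ S, ∀ y ∈ S, P x y := fun x hx y hy => by
    refine hconn.induction₂' P (fun a ha => ?_) (fun a b c _ _ _ => ?_) hx hy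
    · filter_upwards [self_mem_nhdsWithin, mem_nhdsWithin_of_mem_nhds (closedBall_mem_nhds a hr)]
        with b hb hab
      refine ⟨⟨1, fun u A _ _ h => ?_⟩, ⟨1, fun u A _ _ h => ?_⟩⟩
      · rw [pow_one]
        exact h a ha b hb (by rwa [dist_comm])
      · rw [pow_one]
        exact h b hb a ha hab
    · rintro ⟨m, hm⟩ ⟨n, hn⟩
      refine ⟨m + n, fun u A hA h0 h => (hm u A hA h0 h).trans ?_⟩
      rw [pow_add, mul_assoc]
      exact mul_le_mul_of_nonneg_left (hn u A hA h0 h) (by positivity)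
  obtain ⟨t, htS, htfin, hcover⟩ := hS.finite_cover_balls hr
  choose! n hn using hP
  lift t to Finset X using htfin
  -- The sum bounds the step count for every pair of net points; the two extra steps join `a` and
  -- `b` to the net.
  refine ⟨1 + (∑ p ∈ t ×ˢ t, n p.1 p.2) + 1, fun u A hA h0 h a ha b hb => ?_⟩
  obtain ⟨x, hx, hax⟩ := Set.mem_iUnion₂.1 (hcover ha)
  obtain ⟨y, hy, hby⟩ := Set.mem_iUnion₂.1 (hcover hb)
  have hle : n x y ≤ ∑ p ∈ t ×ˢ t, n p.1 p.2 :=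
    Finset.single_le_sum (f := fun p : X × X => n p.1 p.2) (fun _ _ => Nat.zero_le _)
      (Finset.mk_mem_product hx hy)
  have hA0 : 0 ≤ A := zero_le_one.trans hA
  have h1 := h a ha x (htS hx) (mem_ball.1 hax).le
  have h2 : u x ≤ A ^ (∑ p ∈ t ×ˢ t, n p.1 p.2) * u y :=
    (hn x (htS hx) y (htS hy) u A hA h0 h).trans
      (mul_le_mul_of_nonneg_right (pow_le_pow_right₀ hA hle) (h0 y (htS hy)))
  have h3 := h y (htS hy) b hb (by rw [dist_comm]; exact (mem_ball.1 hby).le)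
  calc u a ≤ A * u x := h1
    _ ≤ A * (A ^ (∑ p ∈ t ×ˢ t, n p.1 p.2) * (A * u b)) := by
      refine mul_le_mul_of_nonneg_left (h2.trans ?_) hA0
      exact mul_le_mul_of_nonneg_left h3 (pow_nonneg hA0 _)
    _ = _ := by ring

end Chain

/-! ### From the equation to the global inequality -/

/-- The a.e. equation gives the pointwise bounds `0 ≤ Δ u ≤ (lam + M) u`. -/
lemma IsC2Solution.laplacian_bounds {d : ℕ} {Ω : Set (EuclideanSpace ℝ (Fin d))} (hΩ : IsOpen Ω)
    {p : EuclideanSpace ℝ (Fin d) → ℝ} {M : ℝ≥0}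
    (hpM : eLpNorm p ∞ (volume.restrict Ω) ≤ (M : ℝ≥0∞))
    (hp0 : ∀ᵐ x ∂(volume.restrict Ω), 0 ≤ p x) {lam : ℝ} (hlam : 0 < lam)
    {u : EuclideanSpace ℝ (Fin d) → ℝ} (hu : IsC2Solution Ω p lam u) (hu0 : ∀ x ∈ Ω, 0 ≤ u x) :
    ∀ x ∈ Ω, 0 ≤ Laplacian.laplacian u x ∧ Laplacian.laplacian u x ≤ (lam + M) * u x := by
  have hlap := hu.1.continuousOn_laplacian hΩ
  have huc := hu.1.continuousOn
  have hpM' : ∀ᵐ x ∂(volume.restrict Ω), p x ≤ M := by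
    filter_upwards [ae_le_eLpNormEssSup (f := p) (μ := volume.restrict Ω)] with x hx
    rw [eLpNorm_exponent_top] at hpM
    have h1 : ‖p x‖ ≤ M := by exact_mod_cast hx.trans hpM
    exact (Real.le_norm_self _).trans h1
  have hae : ∀ᵐ x ∂(volume.restrict Ω),
      0 ≤ Laplacian.laplacian u x ∧ Laplacian.laplacian u x ≤ (lam + M) * u x := by
    filter_upwards [hu.2, hp0, hpM', ae_restrict_mem hΩ.measurableSet] with x h1 h2 h3 hx
    have h4 := hu0 x hx
    have h5 : Laplacian.laplacian u x = (lam + p x) * u x := by linarith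
    rw [h5]
    exact ⟨by positivity, by gcongr⟩
  -- Written with `min`, an a.e. inequality is an a.e. equality of continuous functions, which holds
  -- everywhere on an open set.
  have hlow : Set.EqOn (fun x => min (Laplacian.laplacian u x) 0) (fun _ => (0 : ℝ)) Ω := by
    refine Measure.eqOn_open_of_ae_eq (μ := volume) ?_ hΩ (by fun_prop) continuousOn_const
    filter_upwards [hae] with x hx using min_eq_right hx.1
  have hupp : Set.EqOn (fun x => min (Laplacian.laplacian u x) ((lam + M) * u x))
      (fun x => Laplacian.laplacian u x) Ω := by
    refine Measure.eqOn_open_of_ae_eq (μ := volume) ?_ hΩ (by fun_prop) hlap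
    filter_upwards [hae] with x hx using min_eq_left hx.2
  exact fun x hx => ⟨min_eq_right_iff.1 (hlow hx), min_eq_left_iff.1 (hupp hx)⟩

theorem lemma3p1 (d : ℕ) (hd : 1 ≤ d) (Ω U : Set (EuclideanSpace ℝ (Fin d)))
    (hΩ : IsDomainIn Ω) (hU : IsDomainIn U) (hUΩ : CompactlyContained U Ω) (M : ℝ≥0) :
    ∃ C : ℝ, 0 < C ∧
      ∀ p : EuclideanSpace ℝ (Fin d) → ℝ,
        MemLp p ∞ (volume.restrict Ω) →
        eLpNorm p ∞ (volume.restrict Ω) ≤ (M : ℝ≥0∞) →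
        (∀ᵐ x ∂(volume.restrict Ω), 0 ≤ p x) →
      ∀ lam : ℝ, 0 < lam →
      ∀ u : EuclideanSpace ℝ (Fin d) → ℝ,
        IsC2Solution Ω p lam u →
        (∀ x ∈ Ω, 0 ≤ u x) →
        BddAbove (u '' U) ∧
          sSup (u '' U) ≤ Real.exp (C * (1 + lam)) * sInf (u '' U) := by
  obtain ⟨δ, hδ, hδΩ⟩ := hUΩ.1.exists_cthickening_subset_open hΩ.1 hUΩ.2
  set r := δ / 5 with hr_def
  have hr : 0 < r := by positivity
  obtain ⟨N, hN⟩ := hUΩ.1.exists_harnack_chain hU.2.isPreconnected.closure hr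
  set c := Real.log (4 / 3 * 4 ^ Module.finrank ℝ (EuclideanSpace ℝ (Fin d)))
  have h43 : (1 : ℝ) ≤ 4 / 3 * 4 ^ Module.finrank ℝ (EuclideanSpace ℝ (Fin d)) :=
    one_le_mul_of_one_le_of_one_le (by norm_num) (one_le_pow₀ (by norm_num))
  have hc : 0 ≤ c := Real.log_nonneg h43
  -- By `lam + M ≤ (1 + M) * (1 + lam)`, the local constant is at most `exp (B * (1 + lam))`.
  set B := c + 2 * (1 + M) * r ^ 2
  have hB : 0 ≤ B := by positivity
  -- The `+ 1` gives positivity even if `N * B = 0`.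
  refine ⟨N * B + 1, by positivity, fun p _ hpM hp0 lam hlam u hu hu0 => ?_⟩
  have hbounds := hu.laplacian_bounds hΩ.1 hpM hp0 hlam hu0
  have hM : (0 : ℝ) ≤ M := M.2
  have hUΩ' : U ⊆ Ω := subset_closure.trans hUΩ.2
  have hstep : ∀ a ∈ closure U, ∀ b ∈ closure U, dist a b ≤ r →
      u a ≤ Real.exp (B * (1 + lam)) * u b := fun a _ b hb hab => by
    have hball : Metric.closedBall b (5 * r) ⊆ Ω := by
      rw [hr_def, mul_div_cancel₀ δ (by norm_num : (5 : ℝ) ≠ 0)]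
      exact (Metric.closedBall_subset_cthickening hb δ).trans hδΩ
    refine (harnack_closedBall hΩ.1 hu.1 (by positivity : 0 ≤ lam + M) hu0
      (fun z hz => (hbounds z hz).1) (fun z hz => (hbounds z hz).2) hr hab hball).trans
      (mul_le_mul_of_nonneg_right ?_ (hu0 b (hUΩ.2 hb)))
    rw [← Real.exp_log (by positivity :
      (0 : ℝ) < 4 / 3 * 4 ^ Module.finrank ℝ (EuclideanSpace ℝ (Fin d))), ← Real.exp_add,
      Real.exp_le_exp]
    have h1 : 2 * (lam + M) * r ^ 2 ≤ 2 * ((1 + M) * (1 + lam)) * r ^ 2 := by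
      gcongr
      nlinarith
    have h2 : 0 ≤ c * lam := by positivity
    calc c + 2 * (lam + M) * r ^ 2 ≤ c + c * lam + 2 * ((1 + M) * (1 + lam)) * r ^ 2 := by linarith
      _ = B * (1 + lam) := by ring
  have hall : ∀ a ∈ U, ∀ b ∈ U, u a ≤ Real.exp ((N * B + 1) * (1 + lam)) * u b :=
    fun a ha b hb => by
      refine (hN u _ (Real.one_le_exp (by positivity)) (fun a ha => hu0 a (hUΩ.2 ha)) hstep
        a (subset_closure ha) b (subset_closure hb)).trans
        (mul_le_mul_of_nonneg_right ?_ (hu0 b (hUΩ' hb)))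
      rw [← Real.exp_nat_mul, Real.exp_le_exp]
      nlinarith
  obtain ⟨b₀, hb₀⟩ := hU.2.nonempty
  have hne : (u '' U).Nonempty := ⟨u b₀, b₀, hb₀, rfl⟩
  refine ⟨⟨_, Set.forall_mem_image.2 fun a ha => hall a ha b₀ hb₀⟩, ?_⟩
  refine csSup_le hne (Set.forall_mem_image.2 fun a ha => ?_)
  rw [← div_le_iff₀' (Real.exp_pos _)]
  refine le_csInf hne (Set.forall_mem_image.2 fun b hb => ?_)
  rw [div_le_iff₀' (Real.exp_pos _)]
  exact hall a ha b hb
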